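/- Let \[ C=\left\{\sum_{j=1}^{\infty}\frac{d_j}{3^j} : d_j\in\{0,2\}\text{ for all } j\ge 1\right\}\subset[0,1] \] be the standard middle-third Cantor set, and for every integer $n\ge 1$ let \[ a_n=\prod_{k=1}^{n}(3^k-1). \] Then \[ \left\{\frac{1}{a_n} : n\ge 1\right\}\cap C=\emptyset , \] that is, for no integer $n\ge 1$ does the number $1/a_n$ belong to $C$. -/

import Mathlib

/-- The missing-digit set `K_{m,D}`: the real numbers `∑_{j ≥ 1} a_j / m ^ j` all of whose digits
`a_j` lie in `D`. The digit `a_j` is written `a (j - 1)` here, so that the index runs over `ℕ`. -/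
def missingDigitSet (m : ℕ) (D : Set ℕ) : Set ℝ :=
  {x | ∃ a : ℕ → ℕ, (∀ j, a j ∈ D) ∧ HasSum (fun j : ℕ => (a j : ℝ) / (m : ℝ) ^ (j + 1)) x}

/-- The middle-third Cantor set `C = K_{3,{0,2}}`. -/
def middleThirdCantorSet : Set ℝ := missingDigitSet 3 {0, 2}

/-- `K_{3,{0,2}}` is the Cantor set obtained by repeatedly removing open middle thirds. -/
theorem middleThirdCantorSet_eq_cantorSet : middleThirdCantorSet = cantorSet := by
  rw [cantorSet_eq_zero_two_ofDigits]
  have key : ∀ b : ℕ → Fin 3,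
      HasSum (fun j : ℕ => ((b j : ℕ) : ℝ) / ((3 : ℕ) : ℝ) ^ (j + 1)) (Real.ofDigits b) := by
    intro b
    have h := (Real.summable_ofDigitsTerm (digits := b)).hasSum
    refine h.congr_fun ?_
    intro j
    simp [Real.ofDigitsTerm, div_eq_mul_inv]
  ext x
  constructor
  · rintro ⟨a, ha, hx⟩
    have ha' : ∀ j, a j = 0 ∨ a j = 2 := fun j => by simpa using ha j
    refine ⟨fun j => ⟨a j, by rcases ha' j with h | h <;> omega⟩, ?_, ?_⟩
    · intro j h
      have h1 := congrArg Fin.val h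
      simp at h1
      rcases ha' j with h | h <;> omega
    · exact (key _).unique hx
  · rintro ⟨b, hb, rfl⟩
    refine ⟨fun j => (b j : ℕ), ?_, key b⟩
    intro j
    have := hb j
    have h3 := (b j).isLt
    have h1 : (b j : ℕ) ≠ 1 := fun h => this (Fin.ext h)
    simp only [Set.mem_insert_iff, Set.mem_singleton_iff]
    omega

/-! With `S = 1 + ... + n`, the product `a_n` lies strictly between `3 ^ S / 2` and `3 ^ S`, so `1 /
a_n` falls in the open interval `(1 / 3 ^ S, 2 / 3 ^ S)`, which misses the Cantor set by
self-similarity. -/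

/-- A point of the Cantor set never lies strictly between `1 / 3 ^ N` and `2 / 3 ^ N`. -/
theorem notMem_cantorSet_of_mem_Ioo (N : ℕ) {x : ℝ} (hx : x ∈ Set.Ioo (1 / 3 ^ N) (2 / 3 ^ N)) :
    x ∉ cantorSet := by
  induction N generalizing x with
  | zero =>
    intro h
    have h1 := (cantorSet_subset_unitInterval h).2
    have h2 := hx.1
    norm_num at h2
    linarith
  | succ N ih =>
    obtain ⟨h1, h2⟩ := hx
    rw [pow_succ, ← div_div] at h1 h2
    rw [cantorSet_eq_union_halves]
    rintro (⟨y, hy, rfl⟩ | ⟨y, hy, rfl⟩)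
    · exact ih ⟨by linarith, by linarith⟩ hy
    -- Right-hand copy: its points are at least `2 / 3`, too large.
    · have h3 : (2 : ℝ) / 3 ^ N ≤ 2 := div_le_self (by norm_num) (one_le_pow₀ (by norm_num))
      have h4 := (cantorSet_subset_unitInterval hy).1
      linarith

/-- The bound `∏ (1 - 3 ^ (-k)) > 1 / 2` is not inductive by itself; the extra `1 / 3 ^ n` makes the
induction close. -/
theorem prod_three_pow_mul_le_two_mul_prod_three_pow_sub_one (n : ℕ) :
    (∏ k ∈ Finset.Icc 1 n, (3 : ℝ) ^ k) * (1 + 1 / 3 ^ n) ≤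
      2 * ∏ k ∈ Finset.Icc 1 n, ((3 : ℝ) ^ k - 1) := by
  induction n with
  | zero => norm_num
  | succ n ih =>
    rw [Finset.prod_Icc_succ_top (by omega), Finset.prod_Icc_succ_top (by omega)]
    set B := ∏ k ∈ Finset.Icc 1 n, (3 : ℝ) ^ k
    have hB : 0 < B := Finset.prod_pos fun _ _ => by positivity
    have hq : (1 : ℝ) ≤ 3 ^ n := one_le_pow₀ (by norm_num)
    have hq' : (1 : ℝ) / 3 ^ n ≤ 1 := div_le_one_of_le₀ hq (by positivity)
    calc B * 3 ^ (n + 1) * (1 + 1 / 3 ^ (n + 1))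
        = B * (3 * 3 ^ n + 1) := by field_simp; ring
      _ ≤ B * (3 * 3 ^ n + 2 - 1 / 3 ^ n) := by gcongr; linarith
      _ = B * (1 + 1 / 3 ^ n) * (3 ^ (n + 1) - 1) := by field_simp; ring
      _ ≤ _ := by
        rw [← mul_assoc]
        exact mul_le_mul_of_nonneg_right ih (by rw [pow_succ]; linarith)

theorem mainTheorem12 :
    {x : ℝ | ∃ n : ℕ, 1 ≤ n ∧ x = 1 / ∏ k ∈ Finset.Icc 1 n, ((3 : ℝ) ^ k - 1)} ∩
      middleThirdCantorSet = ∅ := by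
  rw [middleThirdCantorSet_eq_cantorSet, Set.eq_empty_iff_forall_notMem]
  rintro _ ⟨⟨n, hn, rfl⟩, hC⟩
  have hfac : ∀ k ∈ Finset.Icc 1 n, (0 : ℝ) < 3 ^ k - 1 := fun k hk =>
    sub_pos.2 (one_lt_pow₀ (by norm_num) (by grind))
  have hpos := Finset.prod_pos hfac
  have hlt : ∏ k ∈ Finset.Icc 1 n, ((3 : ℝ) ^ k - 1) < ∏ k ∈ Finset.Icc 1 n, (3 : ℝ) ^ k :=
    Finset.prod_lt_prod_of_nonempty hfac (fun _ _ => by linarith) (by simpa using hn)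
  have hle := prod_three_pow_mul_le_two_mul_prod_three_pow_sub_one n
  rw [Finset.prod_pow_eq_pow_sum] at hlt hle
  refine notMem_cantorSet_of_mem_Ioo (∑ k ∈ Finset.Icc 1 n, k) ⟨?_, ?_⟩ hC
  · exact one_div_lt_one_div_of_lt hpos hlt
  · rw [div_lt_div_iff₀ hpos (by positivity), one_mul]
    refine lt_of_lt_of_le ?_ hle
    exact lt_mul_of_one_lt_right (by positivity) (lt_add_of_pos_right _ (by positivity))
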